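/- Fundamental Commutator Identity. Let $(M,g,I)$ be a Kähler manifold, i.e. a smooth manifold with a Riemannian metric $g$ and a smooth $g$-orthogonal almost complex structure $I$ with $\nabla I=0$, where $\nabla$ is the Levi-Civita connection of $g$. Let $R_{X,Y}Z=\nabla_X\nabla_YZ-\nabla_Y\nabla_XZ-\nabla_{[X,Y]}Z$ be the curvature tensor and let $\nabla^2_{X,Y}R$ denote its second iterated covariant derivative, i.e. $\nabla(\nabla R)$ evaluated in the directions $X,Y$ (so that $\nabla^2_{X,Y}=\nabla_X\nabla_Y-\nabla_{\nabla_XY}$ for vector fields $X,Y$). For a tangent vector $X\in T_pM$ the Jacobi operator associated to $X$ is $R_{X,\cdot}X:\,T_pM\to T_pM,\ A\mapsto R_{X,A}X$. Then for all $p\in M$ and all $X,A\in T_pM$ $$ \begin{aligned} 3\,\big[\,R_{X,\cdot}X,\;R_{IX,\cdot}IX\,\big]\,A \;=\;&\tfrac12\,(\nabla^2_{X,IX}R-\nabla^2_{IX,X}R)_{X,IX}A +(\nabla^2_{X,IX}R-\nabla^2_{IX,X}R)_{A,X}IX\\ &+(\nabla^2_{A,X}R-\nabla^2_{X,A}R)_{X,IX}IX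 +(\nabla^2_{A,IX}R-\nabla^2_{IX,A}R)_{X,IX}X . \end{aligned} $$ In particular, if $M$ is hermitean locally symmetric, i.e. $\nabla R=0$, then the Jacobi operators $R_{X,\cdot}X$ and $R_{IX,\cdot}IX$ commute for every $p\in M$ and every $X\in T_pM$. -/

import Mathlib

open Bundle FiberBundle
open scoped Manifold ContDiff

namespace KahlerGeometry

noncomputable section

section Connection

variable {E : Type*} [NormedAddCommGroup E] [NormedSpace ℝ E]
  {M : Type*} [TopologicalSpace M] [ChartedSpace E M] [IsManifold 𝓘(ℝ, E) ∞ M]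

/-- The curvature tensor `R_{u,v} w` at `p` of an affine connection `∇`, i.e. the value at `p` of
`∇_U ∇_V W - ∇_V ∇_U W - ∇_{[U,V]} W`, where `U, V, W` are the vector fields extending
`u, v, w` that are constant in the preferred trivialization of the tangent bundle around `p`
(the value does not depend on this choice of smooth extensions).
In Mathlib's argument order, `cov W q (V q)` is `(∇_V W)(q)`. -/
def curvature (cov : CovariantDerivative 𝓘(ℝ, E) E (fun x : M ↦ TangentSpace 𝓘(ℝ, E) x))
    (p : M) (u v w : TangentSpace 𝓘(ℝ, E) p) : TangentSpace 𝓘(ℝ, E) p :=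
  cov (fun q ↦ cov (extend E w) q (extend E v q)) p u
    - cov (fun q ↦ cov (extend E w) q (extend E u q)) p v
    - cov (extend E w) p
        (VectorField.mlieBracket 𝓘(ℝ, E) (extend E u) (extend E v) p)

/-- The covariant derivative `∇T` of a tangent-vector-valued tensor field `T` with `n` arguments:
`(∇T)(x, v₁, …, vₙ) = ∇_x (T(V₁, …, Vₙ)) - ∑ᵢ T(v₁, …, ∇_x Vᵢ, …, vₙ)`, where `Vᵢ` is the vector
field extending `vᵢ` that is constant in the preferred trivialization around `p`
(for a smooth tensor field the value does not depend on this choice of smooth extensions).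
The new argument, the direction of differentiation, comes first. -/
def covDerivTensor (cov : CovariantDerivative 𝓘(ℝ, E) E (fun x : M ↦ TangentSpace 𝓘(ℝ, E) x))
    {n : ℕ} (T : (p : M) → (Fin n → TangentSpace 𝓘(ℝ, E) p) → TangentSpace 𝓘(ℝ, E) p)
    (p : M) (v : Fin (n + 1) → TangentSpace 𝓘(ℝ, E) p) : TangentSpace 𝓘(ℝ, E) p :=
  cov (fun q ↦ T q (fun i ↦ extend E (v i.succ) q)) p (v 0)
    - ∑ i : Fin n, T p (Function.update (fun j ↦ v j.succ) i (cov (extend E (v i.succ)) p (v 0)))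

/-- The curvature as a tensor field with three arguments, `(u, v, w) ↦ R_{u,v} w`. -/
def curvatureTensor
    (cov : CovariantDerivative 𝓘(ℝ, E) E (fun x : M ↦ TangentSpace 𝓘(ℝ, E) x))
    (p : M) (v : Fin 3 → TangentSpace 𝓘(ℝ, E) p) : TangentSpace 𝓘(ℝ, E) p :=
  curvature cov p (v 0) (v 1) (v 2)

/-- The second iterated covariant derivative `(∇²_{x,y} R)_{a,b} c`, i.e. the tensor `∇(∇R)`
evaluated at `(x, y, a, b, c)`. -/
def secondCovDerivCurvature
    (cov : CovariantDerivative 𝓘(ℝ, E) E (fun x : M ↦ TangentSpace 𝓘(ℝ, E) x))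
    (p : M) (x y a b c : TangentSpace 𝓘(ℝ, E) p) : TangentSpace 𝓘(ℝ, E) p :=
  covDerivTensor cov (covDerivTensor cov (curvatureTensor cov)) p ![x, y, a, b, c]

/-- The skew-symmetrised second covariant derivative `(∇²_{x,y} R - ∇²_{y,x} R)_{a,b} c`. -/
def skewSecondCovDerivCurvature
    (cov : CovariantDerivative 𝓘(ℝ, E) E (fun x : M ↦ TangentSpace 𝓘(ℝ, E) x))
    (p : M) (x y a b c : TangentSpace 𝓘(ℝ, E) p) : TangentSpace 𝓘(ℝ, E) p :=
  secondCovDerivCurvature cov p x y a b c - secondCovDerivCurvature cov p y x a b c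

/-- The connection is locally symmetric: `∇R = 0`. -/
def IsLocallySymmetric
    (cov : CovariantDerivative 𝓘(ℝ, E) E (fun x : M ↦ TangentSpace 𝓘(ℝ, E) x)) : Prop :=
  ∀ (p : M) (x a b c : TangentSpace 𝓘(ℝ, E) p),
    covDerivTensor cov (curvatureTensor cov) p ![x, a, b, c] = 0

/-- The Jacobi operator `R_{x,·} x : a ↦ R_{x,a} x` on `T_p M`. -/
def jacobiOperator
    (cov : CovariantDerivative 𝓘(ℝ, E) E (fun x : M ↦ TangentSpace 𝓘(ℝ, E) x))
    (p : M) (x : TangentSpace 𝓘(ℝ, E) p) (a : TangentSpace 𝓘(ℝ, E) p) :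
    TangentSpace 𝓘(ℝ, E) p :=
  curvature cov p x a x

end Connection

section Kahler

variable {E : Type*} [NormedAddCommGroup E] [NormedSpace ℝ E] [FiniteDimensional ℝ E]
  {M : Type*} [TopologicalSpace M] [ChartedSpace E M] [IsManifold 𝓘(ℝ, E) ∞ M]

/-- `cov` is the Levi-Civita connection of the Riemannian metric `g`: the smooth, torsion-free
connection that satisfies `x (g(Y, Z)) = g(∇_x Y, Z) + g(Y, ∇_x Z)`. -/
structure IsLeviCivita
    (g : ContMDiffRiemannianMetric 𝓘(ℝ, E) ∞ E (fun x : M ↦ TangentSpace 𝓘(ℝ, E) x))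
    (cov : CovariantDerivative 𝓘(ℝ, E) E (fun x : M ↦ TangentSpace 𝓘(ℝ, E) x)) : Prop where
  smooth : cov.ContMDiffCovariantDerivative ∞
  torsion_eq_zero : cov.torsion = 0
  metric : ∀ (p : M) (x : TangentSpace 𝓘(ℝ, E) p) (Y Z : (q : M) → TangentSpace 𝓘(ℝ, E) q),
    MDiffAt (T% Y) p → MDiffAt (T% Z) p →
      d% (fun q ↦ g.inner q (Y q) (Z q)) p x
        = g.inner p (cov Y p x) (Z p) + g.inner p (Y p) (cov Z p x)

/-- `(M, g, J)` is a Kähler manifold with Levi-Civita connection `cov`: `J` is a smooth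
`g`-orthogonal almost complex structure that is parallel for the Levi-Civita connection. -/
structure IsKahler
    (g : ContMDiffRiemannianMetric 𝓘(ℝ, E) ∞ E (fun x : M ↦ TangentSpace 𝓘(ℝ, E) x))
    (cov : CovariantDerivative 𝓘(ℝ, E) E (fun x : M ↦ TangentSpace 𝓘(ℝ, E) x))
    (J : (p : M) → TangentSpace 𝓘(ℝ, E) p →L[ℝ] TangentSpace 𝓘(ℝ, E) p) : Prop where
  isLeviCivita : IsLeviCivita g cov
  smooth : ContMDiff 𝓘(ℝ, E) (𝓘(ℝ, E).prod 𝓘(ℝ, E →L[ℝ] E)) ∞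
    (fun p ↦ TotalSpace.mk' (E →L[ℝ] E)
      (E := fun p : M ↦ TangentSpace 𝓘(ℝ, E) p →L[ℝ] TangentSpace 𝓘(ℝ, E) p) p (J p))
  sq_eq_neg : ∀ (p : M) (x : TangentSpace 𝓘(ℝ, E) p), J p (J p x) = -x
  orthogonal : ∀ (p : M) (x y : TangentSpace 𝓘(ℝ, E) p),
    g.inner p (J p x) (J p y) = g.inner p x y
  parallel : ∀ (p : M) (x : TangentSpace 𝓘(ℝ, E) p) (Y : (q : M) → TangentSpace 𝓘(ℝ, E) q),
    MDiffAt (T% Y) p → cov (fun q ↦ J q (Y q)) p x = J p (cov Y p x)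

end Kahler

end

end KahlerGeometry

/-!
The commutator identity is a pointwise algebraic consequence of two facts: the Ricci identity and
the symmetries of the Kähler curvature tensor.

*Ricci identity* (`skewSecondCovDerivCurvature_eq`). For a torsion-free connection the
skew-symmetrised second covariant derivative `∇²_{x,y} R - ∇²_{y,x} R` is the derivation `R_{x,y}`
applied to `R`, that is
`R_{x,y} (R_{a,b} c) - R_{R_{x,y} a, b} c - R_{a, R_{x,y} b} c - R_{a,b} (R_{x,y} c)`.

*Symmetries.* The first Bianchi identity `curvatureHom_bianchi` is the Jacobi identity of the Lie
bracket; compatibility with the metric makes `R_{x,y}` skew (`IsLeviCivita.inner_curvatureHom`);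
together they give pair symmetry (`pair_symmetry`). Since `∇J = 0`, the operators `R_{x,y}` commute
with `J`, and pair symmetry turns this into `R_{Jx,Jy} = R_{x,y}`.

*Algebra* (`three_smul_commutator`). Put `Y = JX`, `P = R_{X,·} X` and `Q = R_{Y,·} Y`. The
symmetries give `R_{X,Y} = J (P + Q)`, `P J = J Q` and `Q J = J P`, and they express every term of
the right-hand side through `J`, `P` and `Q`, up to three terms that cancel by the Bianchi identity.
What remains is `3 (P Q - Q P) A`. If `∇R = 0`, the right-hand side vanishes.

The analytic work is to compute with the pointwise definitions of `R`, `∇R` and `∇²R`, which use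
extensions of tangent vectors that are smooth only near the base point. All computations are done
with globally smooth vector fields: on a Hausdorff manifold the local extensions can be cut off
(`exists_isSmoothField_eventuallyEq_extend`), and an operation that is additive and linear over
smooth functions depends only on the value of the field at the point
(`SmoothlyTensorialAt.eq_of_apply_eq`). This yields `curvature_apply` for the curvature and
`IsSmoothTensor.covDerivTensor_apply` for the covariant derivative of any smooth tensor field.
-/

open scoped Topology

namespace KahlerGeometry

/-! ### Global smooth vector fields and their cutoffs -/

section SmoothFields

variable {E : Type*} [NormedAddCommGroup E] [NormedSpace ℝ E]
  {M : Type*} [TopologicalSpace M] [ChartedSpace E M] [IsManifold 𝓘(ℝ, E) ∞ M]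

/-- `X` is a globally defined smooth vector field on `M`. -/
def IsSmoothField (X : (q : M) → TangentSpace 𝓘(ℝ, E) q) : Prop :=
  ContMDiff 𝓘(ℝ, E) 𝓘(ℝ, E).tangent ∞ (T% X)

namespace IsSmoothField

variable {X Y : (q : M) → TangentSpace 𝓘(ℝ, E) q} {f : M → ℝ}

lemma mdifferentiableAt (hX : IsSmoothField X) (p : M) : MDiffAt (T% X) p :=
  (hX p).mdifferentiableAt (by simp)

lemma add (hX : IsSmoothField X) (hY : IsSmoothField Y) : IsSmoothField (X + Y) :=
  ContMDiff.add_section hX hY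

lemma sub (hX : IsSmoothField X) (hY : IsSmoothField Y) : IsSmoothField (X - Y) :=
  ContMDiff.sub_section hX hY

lemma smul (hf : ContMDiff 𝓘(ℝ, E) 𝓘(ℝ, ℝ) ∞ f) (hX : IsSmoothField X) :
    IsSmoothField (f • X) :=
  ContMDiff.smul_section hf hX

lemma sum {ι : Type*} {s : Finset ι} {X : ι → (q : M) → TangentSpace 𝓘(ℝ, E) q}
    (hX : ∀ i ∈ s, IsSmoothField (X i)) : IsSmoothField (fun q ↦ ∑ i ∈ s, X i q) :=
  ContMDiff.sum_section hX

end IsSmoothField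

variable [FiniteDimensional ℝ E] [T2Space M]

lemma exists_smooth_cutoff {p : M} {U : Set M} (hU : U ∈ 𝓝 p) :
    ∃ χ : M → ℝ, ContMDiff 𝓘(ℝ, E) 𝓘(ℝ, ℝ) ∞ χ ∧ χ =ᶠ[𝓝 p] 1 ∧ tsupport χ ⊆ U := by
  obtain ⟨f, -, hf⟩ := (SmoothBumpFunction.nhds_basis_tsupport (I := 𝓘(ℝ, E)) p).mem_iff.1 hU
  exact ⟨f, f.contMDiff, f.eventuallyEq_one, hf⟩

lemma exists_smooth_eventuallyEq {p : M} {U : Set M} (hU : IsOpen U) (hp : p ∈ U) {f : M → ℝ}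
    (hf : ContMDiffOn 𝓘(ℝ, E) 𝓘(ℝ, ℝ) ∞ f U) :
    ∃ g : M → ℝ, ContMDiff 𝓘(ℝ, E) 𝓘(ℝ, ℝ) ∞ g ∧ g =ᶠ[𝓝 p] f := by
  obtain ⟨χ, hχ, hχ1, hχU⟩ := exists_smooth_cutoff (E := E) (hU.mem_nhds hp)
  refine ⟨χ • f, contMDiff_of_tsupport fun x hx ↦ ?_, ?_⟩
  · have hxU : x ∈ U := hχU (tsupport_smul_subset_left χ f hx)
    exact hχ.contMDiffAt.smul (hf.contMDiffAt (hU.mem_nhds hxU))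
  · filter_upwards [hχ1] with q hq
    simp [hq]

lemma exists_isSmoothField_eventuallyEq {p : M} {U : Set M} (hU : IsOpen U) (hp : p ∈ U)
    {σ : (q : M) → TangentSpace 𝓘(ℝ, E) q}
    (hσ : ContMDiffOn 𝓘(ℝ, E) 𝓘(ℝ, E).tangent ∞ (T% σ) U) :
    ∃ X : (q : M) → TangentSpace 𝓘(ℝ, E) q, IsSmoothField X ∧ X =ᶠ[𝓝 p] σ := by
  obtain ⟨χ, hχ, hχ1, hχU⟩ := exists_smooth_cutoff (E := E) (hU.mem_nhds hp)
  refine ⟨χ • σ, ContMDiffOn.smul_section_of_tsupport hχ.contMDiffOn hU hχU hσ, ?_⟩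
  filter_upwards [hχ1] with q hq
  rw [Pi.smul_apply', hq, Pi.one_apply, one_smul]

/-- Every tangent vector extends to a global smooth field that agrees near the base point with the
field which is constant in the preferred trivialization. -/
lemma exists_isSmoothField_eventuallyEq_extend {p : M} (v : TangentSpace 𝓘(ℝ, E) p) :
    ∃ X : (q : M) → TangentSpace 𝓘(ℝ, E) q,
      IsSmoothField X ∧ X =ᶠ[𝓝 p] (extend E v : (q : M) → TangentSpace 𝓘(ℝ, E) q) ∧ X p = v := by
  obtain ⟨s, hs, hsσ⟩ := exists_contMDiffOn_extend 𝓘(ℝ, E) E (k := ∞) v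
  obtain ⟨U, hUs, hU, hp⟩ := mem_nhds_iff.1 hs
  obtain ⟨X, hX, hXe⟩ := exists_isSmoothField_eventuallyEq hU hp (hsσ.mono hUs)
  exact ⟨X, hX, hXe, hXe.self_of_nhds.trans (extend_apply_self E v)⟩

lemma exists_isSmoothField_apply_eq {p : M} (v : TangentSpace 𝓘(ℝ, E) p) :
    ∃ X : (q : M) → TangentSpace 𝓘(ℝ, E) q, IsSmoothField X ∧ X p = v :=
  (exists_isSmoothField_eventuallyEq_extend v).imp fun _ h ↦ ⟨h.1, h.2.2⟩

end SmoothFields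

/-! ### Operations that are tensorial on smooth fields -/

section Tensoriality

variable {E : Type*} [NormedAddCommGroup E] [NormedSpace ℝ E]
  {M : Type*} [TopologicalSpace M] [ChartedSpace E M] [IsManifold 𝓘(ℝ, E) ∞ M]
  {A : Type*} [AddCommGroup A] [Module ℝ A]

/-- An operation `Φ` on vector fields is *smoothly tensorial* at `p` if on global smooth fields it
is additive and linear over smooth functions. In contrast to `TensorialAt`, nothing is required
for fields and functions that are merely differentiable at `p`; this is needed for operations
that differentiate twice. -/
structure SmoothlyTensorialAt (Φ : ((q : M) → TangentSpace 𝓘(ℝ, E) q) → A) (p : M) : Prop where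
  smul : ∀ {f : M → ℝ} {X : (q : M) → TangentSpace 𝓘(ℝ, E) q},
    ContMDiff 𝓘(ℝ, E) 𝓘(ℝ, ℝ) ∞ f → IsSmoothField X → Φ (f • X) = f p • Φ X
  add : ∀ {X Y : (q : M) → TangentSpace 𝓘(ℝ, E) q},
    IsSmoothField X → IsSmoothField Y → Φ (X + Y) = Φ X + Φ Y

namespace SmoothlyTensorialAt

variable {Φ : ((q : M) → TangentSpace 𝓘(ℝ, E) q) → A} {p : M}

lemma zero (hΦ : SmoothlyTensorialAt Φ p) : Φ 0 = 0 := by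
  have h0 : IsSmoothField (0 : (q : M) → TangentSpace 𝓘(ℝ, E) q) :=
    Bundle.contMDiff_zeroSection ℝ (fun q : M ↦ TangentSpace 𝓘(ℝ, E) q)
  simpa using hΦ.add h0 h0

lemma sum (hΦ : SmoothlyTensorialAt Φ p) {ι : Type*} {s : Finset ι}
    {X : ι → (q : M) → TangentSpace 𝓘(ℝ, E) q} (hX : ∀ i ∈ s, IsSmoothField (X i)) :
    Φ (fun q ↦ ∑ i ∈ s, X i q) = ∑ i ∈ s, Φ (X i) := by
  classical
  induction s using Finset.induction_on with
  | empty => simpa using! hΦ.zero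
  | insert a s ha h =>
    simp only [Finset.mem_insert, forall_eq_or_imp] at hX
    simp only [Finset.sum_insert ha, ← h hX.2]
    exact hΦ.add hX.1 (.sum hX.2)

variable [FiniteDimensional ℝ E] [T2Space M]

lemma eq_of_eventuallyEq (hΦ : SmoothlyTensorialAt Φ p)
    {X Y : (q : M) → TangentSpace 𝓘(ℝ, E) q} (hX : IsSmoothField X) (hY : IsSmoothField Y)
    (h : X =ᶠ[𝓝 p] Y) : Φ X = Φ Y := by
  obtain ⟨χ, hχ, hχ1, hχU⟩ := exists_smooth_cutoff (E := E) h
  have hχp : χ p = 1 := hχ1.self_of_nhds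
  have hXY : χ • X = χ • Y := by
    funext q
    by_cases hq : q ∈ tsupport χ
    · have : X q = Y q := hχU hq
      simp [this]
    · simp [image_eq_zero_of_notMem_tsupport hq]
  calc Φ X = Φ (χ • X) := by simp [hΦ.smul hχ hX, hχp]
    _ = Φ (χ • Y) := by rw [hXY]
    _ = Φ Y := by simp [hΦ.smul hχ hY, hχp]

/-- A smoothly tensorial operation depends only on the value of the field at the point. -/
lemma eq_of_apply_eq (hΦ : SmoothlyTensorialAt Φ p)
    {X Y : (q : M) → TangentSpace 𝓘(ℝ, E) q} (hX : IsSmoothField X) (hY : IsSmoothField Y)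
    (h : X p = Y p) : Φ X = Φ Y := by
  let t := trivializationAt E (fun q : M ↦ TangentSpace 𝓘(ℝ, E) q) p
  have hp : p ∈ t.baseSet := FiberBundle.mem_baseSet_trivializationAt E _ p
  let b := Module.finBasis ℝ E
  have hs (i) := exists_isSmoothField_eventuallyEq t.open_baseSet hp
    (t.contMDiffOn_localFrame_baseSet (I := 𝓘(ℝ, E)) ∞ b i)
  choose s hs hst using hs
  -- the coefficients in the frame, cut off to global smooth functions
  have key : ∀ Z : (q : M) → TangentSpace 𝓘(ℝ, E) q, IsSmoothField Z →
      Φ Z = ∑ i, t.localFrameCoeff 𝓘(ℝ, E) b i p (Z p) • Φ (s i) := by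
    intro Z hZ
    have hc (i) := exists_smooth_eventuallyEq (E := E) t.open_baseSet hp
      (contMDiffOn_baseSet_localFrameCoeff (I := 𝓘(ℝ, E)) (k := ∞) b
        (ContMDiff.contMDiffOn hZ) i)
    choose c hc hct using hc
    have hcs (i) (_ : i ∈ Finset.univ) : IsSmoothField (c i • s i) := (hs i).smul (hc i)
    rw [hΦ.eq_of_eventuallyEq hZ (Y := fun q ↦ ∑ i, (c i • s i) q) (.sum hcs), hΦ.sum hcs]
    · refine Finset.sum_congr rfl fun i _ ↦ ?_
      rw [hΦ.smul (hc i) (hs i), (hct i).self_of_nhds]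
      rfl
    · have hall : ∀ᶠ q in 𝓝 p, ∀ i, c i q = t.localFrameCoeff 𝓘(ℝ, E) b i q (Z q) ∧
          s i q = t.localFrame b i q :=
        Filter.eventually_all.2 fun i ↦ (hct i).and (hst i)
      filter_upwards [hall, t.eventually_eq_localFrame_sum_coeff_smul (I := 𝓘(ℝ, E)) b hp (s := Z)]
        with q hq hZq
      rw [hZq]
      refine Finset.sum_congr rfl fun i _ ↦ ?_
      rw [← (hq i).1, ← (hq i).2]
      rfl
  rw [key X hX, key Y hY, h]

end SmoothlyTensorialAt

end Tensoriality

/-! ### Covariant derivatives of smooth fields -/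

section CovariantDerivative

variable {E : Type*} [NormedAddCommGroup E] [NormedSpace ℝ E]
  {M : Type*} [TopologicalSpace M] [ChartedSpace E M] [IsManifold 𝓘(ℝ, E) ∞ M]
  {cov : CovariantDerivative 𝓘(ℝ, E) E (fun x : M ↦ TangentSpace 𝓘(ℝ, E) x)}
  {X Y : (q : M) → TangentSpace 𝓘(ℝ, E) q}

lemma contMDiff_mvfderiv_apply {f : M → ℝ} (hf : ContMDiff 𝓘(ℝ, E) 𝓘(ℝ, ℝ) ∞ f)
    (hX : IsSmoothField X) :
    ContMDiff 𝓘(ℝ, E) 𝓘(ℝ, ℝ) ∞ (fun q ↦ d% f q (X q)) :=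
  (contMDiff_snd_tangentBundle_modelSpace ℝ 𝓘(ℝ, ℝ)).comp
    ((hf.contMDiff_tangentMap (m := ∞) (by simp)).comp hX)

lemma IsSmoothField.covDeriv (hsm : cov.ContMDiffCovariantDerivative ∞)
    (hX : IsSmoothField X) (hY : IsSmoothField Y) : IsSmoothField (fun q ↦ cov Y q (X q)) := by
  have h := hsm.contMDiff.contMDiff (σ := Y) (by simpa using! ContMDiff.contMDiffOn hY)
  rw [contMDiffOn_univ] at h
  exact ContMDiff.clm_bundle_apply (b := id) h hX

lemma cov_congr {p : M} {σ : (q : M) → TangentSpace 𝓘(ℝ, E) q} (hX : IsSmoothField X)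
    (h : X =ᶠ[𝓝 p] σ) : cov σ p = cov X p := by
  have h1 : MDiffAt (T% σ) p := (hX.mdifferentiableAt p).congr_of_eventuallyEq
    (h.symm.mono fun q hq ↦ by simp [hq])
  exact cov.isCovariantDerivativeOn.congr_of_eventuallyEq h1 (hX.mdifferentiableAt p)
    Filter.univ_mem h.symm

lemma cov_add (hX : IsSmoothField X) (hY : IsSmoothField Y) (p : M) :
    cov (X + Y) p = cov X p + cov Y p :=
  cov.isCovariantDerivativeOnUniv.add (hX.mdifferentiableAt p) (hY.mdifferentiableAt p)

lemma cov_smul {f : M → ℝ} (hf : ContMDiff 𝓘(ℝ, E) 𝓘(ℝ, ℝ) ∞ f) (hX : IsSmoothField X)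
    (p : M) (x : TangentSpace 𝓘(ℝ, E) p) :
    cov (f • X) p x = f p • cov X p x + d% f p x • X p := by
  rw [cov.isCovariantDerivativeOnUniv.leibniz (hX.mdifferentiableAt p)
    ((hf p).mdifferentiableAt (by simp))]
  simp

lemma cov_sub (hX : IsSmoothField X) (hY : IsSmoothField Y) (p : M) :
    cov (X - Y) p = cov X p - cov Y p := by
  rw [eq_sub_iff_add_eq, ← cov_add (hX.sub hY) hY, sub_add_cancel]

/-- The field `∇_X ∇_Y Z - ∇_Y ∇_X Z - ∇_{[X, Y]} Z`. -/
noncomputable def curvatureField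
    (cov : CovariantDerivative 𝓘(ℝ, E) E (fun x : M ↦ TangentSpace 𝓘(ℝ, E) x))
    (X Y Z : (q : M) → TangentSpace 𝓘(ℝ, E) q) (p : M) : TangentSpace 𝓘(ℝ, E) p :=
  cov (fun q ↦ cov Z q (Y q)) p (X p) - cov (fun q ↦ cov Z q (X q)) p (Y p)
    - cov Z p (VectorField.mlieBracket 𝓘(ℝ, E) X Y p)

lemma curvatureField_swap (X Y Z : (q : M) → TangentSpace 𝓘(ℝ, E) q) (p : M) :
    curvatureField cov X Y Z p = -curvatureField cov Y X Z p := by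
  rw [curvatureField, curvatureField, VectorField.mlieBracket_swap_apply, map_neg]
  module

end CovariantDerivative

/-! ### Lie brackets -/

section LieBracket

variable {E : Type*} [NormedAddCommGroup E] [NormedSpace ℝ E] [FiniteDimensional ℝ E]
  {M : Type*} [TopologicalSpace M] [ChartedSpace E M] [IsManifold 𝓘(ℝ, E) ∞ M]

lemma IsSmoothField.mlieBracket {X Y : (q : M) → TangentSpace 𝓘(ℝ, E) q} (hX : IsSmoothField X)
    (hY : IsSmoothField Y) : IsSmoothField (VectorField.mlieBracket 𝓘(ℝ, E) X Y) := by
  have : IsManifold 𝓘(ℝ, E) (((⊤ : ℕ∞) : ℕ∞ω) + 1) M :=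
    inferInstanceAs (IsManifold 𝓘(ℝ, E) ∞ M)
  have : IsManifold 𝓘(ℝ, E) (minSmoothness ℝ 3) M := by
    rw [minSmoothness_of_isRCLikeNormedField]
    exact IsManifold.of_le (n := ∞) (WithTop.coe_le_coe.2 (le_top : (3 : ℕ∞) ≤ ⊤))
  exact fun p ↦ ContMDiffAt.mlieBracket_vectorField (n := ⊤) (m := ⊤) (hX p) (hY p)
    (by rw [minSmoothness_of_isRCLikeNormedField]; exact le_rfl)

/-- The Jacobi identity. -/
lemma IsSmoothField.leibniz_identity_mlieBracket {X Y Z : (q : M) → TangentSpace 𝓘(ℝ, E) q}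
    (hX : IsSmoothField X) (hY : IsSmoothField Y) (hZ : IsSmoothField Z) (p : M) :
    VectorField.mlieBracket 𝓘(ℝ, E) X (VectorField.mlieBracket 𝓘(ℝ, E) Y Z) p
      = VectorField.mlieBracket 𝓘(ℝ, E) (VectorField.mlieBracket 𝓘(ℝ, E) X Y) Z p
        + VectorField.mlieBracket 𝓘(ℝ, E) Y (VectorField.mlieBracket 𝓘(ℝ, E) X Z) p := by
  have : IsManifold 𝓘(ℝ, E) (minSmoothness ℝ 3) M := by
    rw [minSmoothness_of_isRCLikeNormedField]
    exact IsManifold.of_le (n := ∞) (WithTop.coe_le_coe.2 (le_top : (3 : ℕ∞) ≤ ⊤))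
  have h2 {U : (q : M) → TangentSpace 𝓘(ℝ, E) q} (hU : IsSmoothField U) :
      CMDiffAt (minSmoothness ℝ 2) (T% U) p := by
    rw [minSmoothness_of_isRCLikeNormedField]
    exact (hU p).of_le (WithTop.coe_le_coe.2 (le_top : (2 : ℕ∞) ≤ ⊤))
  exact VectorField.leibniz_identity_mlieBracket_apply (h2 hX) (h2 hY) (h2 hZ)

variable [T2Space M]

open VectorField in
/-- `[X, Y] f = X (Y f) - Y (X f)`, for functions `f` such that `X f` and `Y f` are differentiable.
It follows from the Jacobi identity for `X`, `Y` and `f Z`, where `Z` does not vanish at `p`. -/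
lemma mvfderiv_mlieBracket {X Y : (q : M) → TangentSpace 𝓘(ℝ, E) q} {f : M → ℝ}
    (hX : IsSmoothField X) (hY : IsSmoothField Y) (hf : ContMDiff 𝓘(ℝ, E) 𝓘(ℝ, ℝ) ∞ f) {p : M}
    (hXf : MDiffAt (fun q ↦ d% f q (X q)) p) (hYf : MDiffAt (fun q ↦ d% f q (Y q)) p) :
    d% f p (mlieBracket 𝓘(ℝ, E) X Y p)
      = d% (fun q ↦ d% f q (Y q)) p (X p) - d% (fun q ↦ d% f q (X q)) p (Y p) := by
  by_cases hE : ∃ z : TangentSpace 𝓘(ℝ, E) p, z ≠ 0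
  swap
  · push Not at hE
    rw [hE (mlieBracket 𝓘(ℝ, E) X Y p), hE (X p), hE (Y p)]
    simp
  obtain ⟨z, hz⟩ := hE
  obtain ⟨Z, hZ, -, rfl⟩ := exists_isSmoothField_eventuallyEq_extend z
  have hfd (q : M) : MDiffAt f q := (hf q).mdifferentiableAt (by simp)
  have hbr {U V : (q : M) → TangentSpace 𝓘(ℝ, E) q} (hU : IsSmoothField U)
      (hV : IsSmoothField V) : MDiffAt (T% (mlieBracket 𝓘(ℝ, E) U V)) p :=
    (hU.mlieBracket hV).mdifferentiableAt p
  have hfun {U : (q : M) → TangentSpace 𝓘(ℝ, E) q} :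
      mlieBracket 𝓘(ℝ, E) U (f • Z)
        = (fun q ↦ d% f q (U q)) • Z + f • mlieBracket 𝓘(ℝ, E) U Z :=
    funext fun q ↦ mlieBracket_smul_right (hfd q) (hZ.mdifferentiableAt q)
  have hJ := hX.leibniz_identity_mlieBracket hY (hZ.smul hf) p
  have hJ0 := hX.leibniz_identity_mlieBracket hY hZ p
  have hs {h : M → ℝ} (hh : MDiffAt h p) : MDiffAt (T% (h • Z)) p :=
    hh.smul_section (hZ.mdifferentiableAt p)
  rw [hfun, hfun, hfun, mlieBracket_add_right (hs hYf) ((hfd p).smul_section (hbr hY hZ)),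
    mlieBracket_add_right (hs hXf) ((hfd p).smul_section (hbr hX hZ)),
    mlieBracket_smul_right hYf (hZ.mdifferentiableAt p),
    mlieBracket_smul_right (hfd p) (hbr hY hZ),
    mlieBracket_smul_right hXf (hZ.mdifferentiableAt p),
    mlieBracket_smul_right (hfd p) (hbr hX hZ), hJ0] at hJ
  simp only [Pi.add_apply, Pi.smul_apply'] at hJ
  have : (d% f p (mlieBracket 𝓘(ℝ, E) X Y p) - (d% (fun q ↦ d% f q (Y q)) p (X p)
      - d% (fun q ↦ d% f q (X q)) p (Y p))) • Z p = 0 := by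
    rw [← sub_eq_zero] at hJ
    rw [← neg_eq_zero, ← hJ]
    module
  exact sub_eq_zero.1 ((smul_eq_zero.1 this).resolve_right hz)

end LieBracket

/-! ### Tensoriality of the curvature -/

section Curvature

variable {E : Type*} [NormedAddCommGroup E] [NormedSpace ℝ E] [FiniteDimensional ℝ E]
  {M : Type*} [TopologicalSpace M] [ChartedSpace E M] [IsManifold 𝓘(ℝ, E) ∞ M]
  {cov : CovariantDerivative 𝓘(ℝ, E) E (fun x : M ↦ TangentSpace 𝓘(ℝ, E) x)}
  {X Y Z : (q : M) → TangentSpace 𝓘(ℝ, E) q}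

lemma IsSmoothField.curvatureField (hsm : cov.ContMDiffCovariantDerivative ∞)
    (hX : IsSmoothField X) (hY : IsSmoothField Y) (hZ : IsSmoothField Z) :
    IsSmoothField (curvatureField cov X Y Z) :=
  (((hY.covDeriv hsm hZ |> hX.covDeriv hsm).sub (hX.covDeriv hsm hZ |> hY.covDeriv hsm))).sub
    ((hX.mlieBracket hY).covDeriv hsm hZ)

lemma smoothlyTensorialAt_curvatureField_left (hsm : cov.ContMDiffCovariantDerivative ∞)
    (Y : (q : M) → TangentSpace 𝓘(ℝ, E) q) (hZ : IsSmoothField Z) (p : M) :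
    SmoothlyTensorialAt (curvatureField cov · Y Z p) p where
  add {X X'} hX hX' := by
    have h : (fun q ↦ cov Z q ((X + X') q)) = (fun q ↦ cov Z q (X q)) + fun q ↦ cov Z q (X' q) := by
      ext q; simp
    change curvatureField cov (X + X') Y Z p
      = curvatureField cov X Y Z p + curvatureField cov X' Y Z p
    rw [curvatureField, h, cov_add (hX.covDeriv hsm hZ) (hX'.covDeriv hsm hZ),
      VectorField.mlieBracket_add_left (hX.mdifferentiableAt p) (hX'.mdifferentiableAt p)]
    simp only [curvatureField, Pi.add_apply, map_add, add_apply]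
    module
  smul {f X} hf hX := by
    have h : (fun q ↦ cov Z q ((f • X) q)) = f • (fun q ↦ cov Z q (X q)) := by
      ext q; simp
    change curvatureField cov (f • X) Y Z p = f p • curvatureField cov X Y Z p
    rw [curvatureField, h, cov_smul hf (hX.covDeriv hsm hZ),
      VectorField.mlieBracket_smul_left ((hf p).mdifferentiableAt (by simp))
        (hX.mdifferentiableAt p)]
    simp only [curvatureField, Pi.smul_apply', map_add, map_smul]
    module

lemma smoothlyTensorialAt_curvatureField_middle (hsm : cov.ContMDiffCovariantDerivative ∞)
    (X : (q : M) → TangentSpace 𝓘(ℝ, E) q) (hZ : IsSmoothField Z) (p : M) :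
    SmoothlyTensorialAt (curvatureField cov X · Z p) p where
  add {Y Y'} hY hY' := by
    simp only [curvatureField_swap X,
      (smoothlyTensorialAt_curvatureField_left hsm X hZ p).add hY hY', neg_add]
  smul {f Y} hf hY := by
    simp only [curvatureField_swap X,
      (smoothlyTensorialAt_curvatureField_left hsm X hZ p).smul hf hY, smul_neg]

variable [T2Space M]

lemma smoothlyTensorialAt_curvatureField_right (hsm : cov.ContMDiffCovariantDerivative ∞)
    (hX : IsSmoothField X) (hY : IsSmoothField Y) (p : M) :
    SmoothlyTensorialAt (curvatureField cov X Y · p) p where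
  add {Z Z'} hZ hZ' := by
    have h (U : (q : M) → TangentSpace 𝓘(ℝ, E) q) : (fun q ↦ cov (Z + Z') q (U q))
        = (fun q ↦ cov Z q (U q)) + fun q ↦ cov Z' q (U q) := by
      ext q; simp [cov_add hZ hZ']
    change curvatureField cov X Y (Z + Z') p
      = curvatureField cov X Y Z p + curvatureField cov X Y Z' p
    rw [curvatureField, h, h, cov_add (hX.covDeriv hsm hZ) (hX.covDeriv hsm hZ'),
      cov_add (hY.covDeriv hsm hZ) (hY.covDeriv hsm hZ'), cov_add hZ hZ']
    simp only [curvatureField, add_apply]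
    module
  smul {f Z} hf hZ := by
    have h (U : (q : M) → TangentSpace 𝓘(ℝ, E) q) : (fun q ↦ cov (f • Z) q (U q))
        = f • (fun q ↦ cov Z q (U q)) + (fun q ↦ d% f q (U q)) • Z := by
      ext q; simp [cov_smul hf hZ]
    have hXf := contMDiff_mvfderiv_apply hf hX
    have hYf := contMDiff_mvfderiv_apply hf hY
    change curvatureField cov X Y (f • Z) p = f p • curvatureField cov X Y Z p
    rw [curvatureField, h, h, cov_add ((hX.covDeriv hsm hZ).smul hf) (hZ.smul hXf),
      cov_add ((hY.covDeriv hsm hZ).smul hf) (hZ.smul hYf), cov_smul hf hZ,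
      mvfderiv_mlieBracket hX hY hf ((hXf p).mdifferentiableAt (by simp))
        ((hYf p).mdifferentiableAt (by simp))]
    simp only [curvatureField, add_apply, cov_smul hf (hX.covDeriv hsm hZ),
      cov_smul hf (hY.covDeriv hsm hZ), cov_smul hXf hZ, cov_smul hYf hZ]
    module

/-- The pointwise curvature tensor is computed by arbitrary global smooth fields. -/
lemma curvature_apply (hsm : cov.ContMDiffCovariantDerivative ∞)
    (hX : IsSmoothField X) (hY : IsSmoothField Y) (hZ : IsSmoothField Z) (p : M) :
    curvature cov p (X p) (Y p) (Z p) = curvatureField cov X Y Z p := by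
  obtain ⟨X', hX', hXe, hXp⟩ := exists_isSmoothField_eventuallyEq_extend (X p)
  obtain ⟨Y', hY', hYe, hYp⟩ := exists_isSmoothField_eventuallyEq_extend (Y p)
  obtain ⟨Z', hZ', hZe, hZp⟩ := exists_isSmoothField_eventuallyEq_extend (Z p)
  have hcov {U} {u : TangentSpace 𝓘(ℝ, E) p} (hU : IsSmoothField U)
      (hUe : U =ᶠ[𝓝 p] (extend E u : (q : M) → TangentSpace 𝓘(ℝ, E) q)) :
      cov (fun q ↦ cov (extend E (Z p)) q (extend E u q)) p = cov (fun q ↦ cov Z' q (U q)) p := by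
    refine cov_congr (hU.covDeriv hsm hZ') ?_
    filter_upwards [hUe, hZe.eventuallyEq_nhds] with q hq hZq
    rw [hq, cov_congr hZ' hZq]
  calc curvature cov p (X p) (Y p) (Z p) = curvatureField cov X' Y' Z' p := by
        rw [curvature, curvatureField, hcov hX' hXe, hcov hY' hYe, cov_congr hZ' hZe,
          hXe.mlieBracket_vectorField_eq hYe, hXp, hYp]
    _ = curvatureField cov X Y' Z' p :=
        (smoothlyTensorialAt_curvatureField_left hsm Y' hZ' p).eq_of_apply_eq hX' hX hXp
    _ = curvatureField cov X Y Z' p :=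
        (smoothlyTensorialAt_curvatureField_middle hsm X hZ' p).eq_of_apply_eq hY' hY hYp
    _ = curvatureField cov X Y Z p :=
        (smoothlyTensorialAt_curvatureField_right hsm hX hY p).eq_of_apply_eq hZ' hZ hZp

end Curvature

/-! ### Covariant derivatives of tensor fields -/

section Update

variable {E : Type*} [NormedAddCommGroup E] [NormedSpace ℝ E]
  {M : Type*} [TopologicalSpace M] [ChartedSpace E M] {n : ℕ}

lemma update_apply_apply (V : Fin n → (q : M) → TangentSpace 𝓘(ℝ, E) q) (i : Fin n)
    (X : (q : M) → TangentSpace 𝓘(ℝ, E) q) (q : M) :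
    (fun j ↦ Function.update V i X j q) = Function.update (fun j ↦ V j q) i (X q) := by
  funext j
  by_cases h : j = i
  · subst h; simp
  · simp [h]

end Update

section Tensors

variable {E : Type*} [NormedAddCommGroup E] [NormedSpace ℝ E]
  {M : Type*} [TopologicalSpace M] [ChartedSpace E M] [IsManifold 𝓘(ℝ, E) ∞ M]
  {cov : CovariantDerivative 𝓘(ℝ, E) E (fun x : M ↦ TangentSpace 𝓘(ℝ, E) x)}
  {n : ℕ} {T : (p : M) → (Fin n → TangentSpace 𝓘(ℝ, E) p) → TangentSpace 𝓘(ℝ, E) p}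

/-- `T` is a smooth tangent-vector-valued tensor field with `n` arguments: it is multilinear at
every point and sends global smooth fields to a smooth field. -/
structure IsSmoothTensor
    (T : (p : M) → (Fin n → TangentSpace 𝓘(ℝ, E) p) → TangentSpace 𝓘(ℝ, E) p) : Prop where
  map_update_add : ∀ (p : M) (v : Fin n → TangentSpace 𝓘(ℝ, E) p) (i : Fin n)
    (x y : TangentSpace 𝓘(ℝ, E) p), T p (Function.update v i (x + y))
      = T p (Function.update v i x) + T p (Function.update v i y)
  map_update_smul : ∀ (p : M) (v : Fin n → TangentSpace 𝓘(ℝ, E) p) (i : Fin n) (c : ℝ)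
    (x : TangentSpace 𝓘(ℝ, E) p),
      T p (Function.update v i (c • x)) = c • T p (Function.update v i x)
  smooth : ∀ V : Fin n → (q : M) → TangentSpace 𝓘(ℝ, E) q, (∀ i, IsSmoothField (V i)) →
    IsSmoothField (fun q ↦ T q (fun i ↦ V i q))

/-- `(∇_x T)(V₁, …, Vₙ)` at `p`, expanded by the Leibniz rule with given fields `Vᵢ`. -/
noncomputable def leibnizExpansion
    (cov : CovariantDerivative 𝓘(ℝ, E) E (fun x : M ↦ TangentSpace 𝓘(ℝ, E) x))
    (T : (p : M) → (Fin n → TangentSpace 𝓘(ℝ, E) p) → TangentSpace 𝓘(ℝ, E) p)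
    (p : M) (x : TangentSpace 𝓘(ℝ, E) p) (V : Fin n → (q : M) → TangentSpace 𝓘(ℝ, E) q) :
    TangentSpace 𝓘(ℝ, E) p :=
  cov (fun q ↦ T q (fun i ↦ V i q)) p x
    - ∑ i : Fin n, T p (Function.update (fun j ↦ V j p) i (cov (V i) p x))

lemma leibnizExpansion_update (p : M) (x : TangentSpace 𝓘(ℝ, E) p)
    (V : Fin n → (q : M) → TangentSpace 𝓘(ℝ, E) q) (i : Fin n)
    (X : (q : M) → TangentSpace 𝓘(ℝ, E) q) :
    leibnizExpansion cov T p x (Function.update V i X)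
      = cov (fun q ↦ T q (Function.update (fun j ↦ V j q) i (X q))) p x
        - (T p (Function.update (fun j ↦ V j p) i (cov X p x))
          + ∑ k ∈ Finset.univ.erase i, T p (Function.update
            (Function.update (fun j ↦ V j p) k (cov (V k) p x)) i (X p))) := by
  simp only [leibnizExpansion, update_apply_apply]
  rw [← Finset.add_sum_erase _ _ (Finset.mem_univ i)]
  congr 2
  · simp
  · refine Finset.sum_congr rfl fun k hk ↦ ?_
    have hki : k ≠ i := Finset.ne_of_mem_erase hk
    rw [Function.update_of_ne hki, Function.update_comm hki]

lemma IsSmoothTensor.smoothlyTensorialAt_leibnizExpansion (hT : IsSmoothTensor T) (p : M)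
    (x : TangentSpace 𝓘(ℝ, E) p) {V : Fin n → (q : M) → TangentSpace 𝓘(ℝ, E) q}
    (hV : ∀ i, IsSmoothField (V i)) (i : Fin n) :
    SmoothlyTensorialAt (fun X ↦ leibnizExpansion cov T p x (Function.update V i X)) p := by
  have hs {X : (q : M) → TangentSpace 𝓘(ℝ, E) q} (hX : IsSmoothField X) :
      IsSmoothField (fun q ↦ T q (Function.update (fun j ↦ V j q) i (X q))) := by
    simp only [← update_apply_apply]
    refine hT.smooth _ fun j ↦ ?_
    by_cases h : j = i
    · subst h; simpa using hX
    · simpa [h] using hV j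
  constructor
  · intro f X hf hX
    have h : (fun q ↦ T q (Function.update (fun j ↦ V j q) i ((f • X) q)))
        = f • fun q ↦ T q (Function.update (fun j ↦ V j q) i (X q)) :=
      funext fun q ↦ hT.map_update_smul q _ i (f q) (X q)
    have h' : (f • X) p = f p • X p := rfl
    rw [leibnizExpansion_update, leibnizExpansion_update, h, cov_smul hf (hs hX), cov_smul hf hX,
      h']
    simp only [hT.map_update_add, hT.map_update_smul, ← Finset.smul_sum]
    module
  · intro X Y hX hY
    have h : (fun q ↦ T q (Function.update (fun j ↦ V j q) i ((X + Y) q)))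
        = (fun q ↦ T q (Function.update (fun j ↦ V j q) i (X q)))
          + fun q ↦ T q (Function.update (fun j ↦ V j q) i (Y q)) :=
      funext fun q ↦ hT.map_update_add q _ i (X q) (Y q)
    have h' : (X + Y) p = X p + Y p := rfl
    rw [leibnizExpansion_update, leibnizExpansion_update, leibnizExpansion_update, h,
      cov_add (hs hX) (hs hY), cov_add hX hY, h', add_apply, add_apply]
    simp only [hT.map_update_add, Finset.sum_add_distrib]
    module

variable [FiniteDimensional ℝ E] [T2Space M]

lemma IsSmoothTensor.leibnizExpansion_congr (hT : IsSmoothTensor T) {p : M}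
    (x : TangentSpace 𝓘(ℝ, E) p) {V W : Fin n → (q : M) → TangentSpace 𝓘(ℝ, E) q}
    (hV : ∀ i, IsSmoothField (V i)) (hW : ∀ i, IsSmoothField (W i)) (h : ∀ i, V i p = W i p) :
    leibnizExpansion cov T p x V = leibnizExpansion cov T p x W := by
  -- replace the fields of `V` by those of `W` one at a time
  have key (s : Finset (Fin n)) :
      leibnizExpansion cov T p x (s.piecewise W V) = leibnizExpansion cov T p x V := by
    induction s using Finset.induction_on with
    | empty => simp
    | insert i s hi ih =>
      have hs (j) : IsSmoothField (s.piecewise W V j) := by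
        by_cases hj : j ∈ s
        · simpa [hj] using hW j
        · simpa [hj] using hV j
      rw [Finset.piecewise_insert, ← ih]
      have := (hT.smoothlyTensorialAt_leibnizExpansion (cov := cov) p x hs i).eq_of_apply_eq
        (hW i) (hV i) (h i).symm
      rw [this]
      congr 1
      rw [Function.update_eq_self_iff]
      simp [hi]
  rw [← key Finset.univ, Finset.piecewise_univ]

/-- The covariant derivative of a smooth tensor field may be computed with arbitrary global
smooth fields extending the arguments. -/
lemma IsSmoothTensor.covDerivTensor_apply (hT : IsSmoothTensor T) {p : M}
    (x : TangentSpace 𝓘(ℝ, E) p) {V : Fin n → (q : M) → TangentSpace 𝓘(ℝ, E) q}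
    (hV : ∀ i, IsSmoothField (V i)) {v : Fin n → TangentSpace 𝓘(ℝ, E) p}
    (hv : ∀ i, V i p = v i) :
    covDerivTensor cov T p (Fin.cons x v) = leibnizExpansion cov T p x V := by
  choose W hW hWe hWp using fun i ↦ exists_isSmoothField_eventuallyEq_extend (v i)
  rw [hT.leibnizExpansion_congr x hV hW fun i ↦ (hv i).trans (hWp i).symm, covDerivTensor,
    leibnizExpansion]
  simp only [Fin.cons_succ, Fin.cons_zero]
  congr 1
  · rw [cov_congr (hT.smooth W hW)]
    filter_upwards [Filter.eventually_all.2 hWe] with q hq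
    exact congrArg (T q) (funext hq)
  · refine Finset.sum_congr rfl fun i _ ↦ ?_
    rw [cov_congr (hW i) (hWe i)]
    simp only [hWp]

/-- The covariant derivative of a smooth tensor field is a smooth tensor field. -/
lemma IsSmoothTensor.covDerivTensor (hsm : cov.ContMDiffCovariantDerivative ∞)
    (hT : IsSmoothTensor T) : IsSmoothTensor (covDerivTensor cov T) := by
  -- in a slot other than the first, the value is an operation tensorial in the field
  have hslot {p : M} (v : Fin (n + 1) → TangentSpace 𝓘(ℝ, E) p) (i : Fin n) :
      ∃ Φ : ((q : M) → TangentSpace 𝓘(ℝ, E) q) → TangentSpace 𝓘(ℝ, E) p,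
        SmoothlyTensorialAt Φ p ∧ ∀ X, IsSmoothField X →
          KahlerGeometry.covDerivTensor cov T p (Function.update v i.succ (X p)) = Φ X := by
    choose V hV hVp using fun j : Fin n ↦ exists_isSmoothField_apply_eq (v j.succ)
    refine ⟨_, hT.smoothlyTensorialAt_leibnizExpansion (cov := cov) p (v 0) hV i,
      fun X hX ↦ ?_⟩
    have hup : Function.update v i.succ (X p)
        = Fin.cons (v 0) (Function.update (fun j ↦ v j.succ) i (X p)) := by
      rw [Fin.cons_update]
      congr 1
      exact (Fin.cons_self_tail v).symm
    rw [hup]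
    refine hT.covDerivTensor_apply (v 0) (fun j ↦ ?_) fun j ↦ ?_
    · by_cases h : j = i
      · subst h; simpa using hX
      · simpa [h] using hV j
    · by_cases h : j = i
      · subst h; simp
      · simp [h, hVp]
  have hzero {p : M} (v : Fin (n + 1) → TangentSpace 𝓘(ℝ, E) p) (x : TangentSpace 𝓘(ℝ, E) p) :
      Function.update v 0 x = Fin.cons x (fun j ↦ v j.succ) := by
    rw [← Fin.update_cons_zero (v 0)]
    congr 1
    exact (Fin.cons_self_tail v).symm
  refine ⟨fun p v i x y ↦ ?_, fun p v i c x ↦ ?_, fun V hV ↦ ?_⟩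
  · induction i using Fin.cases with
    | zero =>
      simp only [hzero, KahlerGeometry.covDerivTensor, Fin.cons_zero, Fin.cons_succ, map_add,
        hT.map_update_add, Finset.sum_add_distrib]
      module
    | succ i =>
      obtain ⟨Φ, hΦ, h⟩ := hslot v i
      obtain ⟨X, hX, rfl⟩ := exists_isSmoothField_apply_eq x
      obtain ⟨Y, hY, rfl⟩ := exists_isSmoothField_apply_eq y
      rw [h X hX, h Y hY, ← hΦ.add hX hY, ← h _ (hX.add hY)]
      rfl
  · induction i using Fin.cases with
    | zero =>
      simp only [hzero, KahlerGeometry.covDerivTensor, Fin.cons_zero, Fin.cons_succ, map_smul,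
        hT.map_update_smul, ← Finset.smul_sum]
      module
    | succ i =>
      obtain ⟨Φ, hΦ, h⟩ := hslot v i
      obtain ⟨X, hX, rfl⟩ := exists_isSmoothField_apply_eq x
      have hc : ContMDiff 𝓘(ℝ, E) 𝓘(ℝ, ℝ) ∞ (fun _ : M ↦ c) := contMDiff_const
      rw [h X hX, ← hΦ.smul hc hX, ← h _ (hX.smul hc)]
      rfl
  · have h : (fun q ↦ KahlerGeometry.covDerivTensor cov T q (fun i ↦ V i q))
        = (fun q ↦ cov (fun q ↦ T q (fun i ↦ V i.succ q)) q (V 0 q))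
          - fun q ↦ ∑ i : Fin n, T q (fun j ↦ Function.update (fun j ↦ V j.succ) i
            (fun q ↦ cov (V i.succ) q (V 0 q)) j q) := by
      funext q
      have : (fun i ↦ V i q) = Fin.cons (V 0 q) (fun i : Fin n ↦ V i.succ q) :=
        (Fin.cons_self_tail _).symm
      rw [this, hT.covDerivTensor_apply (V 0 q) (V := fun i ↦ V i.succ) (fun i ↦ hV i.succ)
        fun i ↦ rfl]
      simp only [leibnizExpansion, update_apply_apply]
      rfl
    rw [h]
    refine ((hV 0).covDeriv hsm (hT.smooth _ fun i ↦ hV i.succ)).sub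
      (.sum fun i _ ↦ hT.smooth _ fun j ↦ ?_)
    by_cases hj : j = i
    · subst hj; simpa using (hV 0).covDeriv hsm (hV j.succ)
    · simpa [hj] using hV j.succ

end Tensors

/-! ### The curvature tensor, the Ricci identity and the first Bianchi identity -/

section CurvatureTensor

variable {E : Type*} [NormedAddCommGroup E] [NormedSpace ℝ E] [FiniteDimensional ℝ E]
  {M : Type*} [TopologicalSpace M] [T2Space M] [ChartedSpace E M] [IsManifold 𝓘(ℝ, E) ∞ M]
  {cov : CovariantDerivative 𝓘(ℝ, E) E (fun x : M ↦ TangentSpace 𝓘(ℝ, E) x)}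
  {A B C X Y Z W : (q : M) → TangentSpace 𝓘(ℝ, E) q}

/-- The curvature of a smooth connection at a point as a trilinear map. -/
noncomputable def curvatureHom (hsm : cov.ContMDiffCovariantDerivative ∞) (p : M) :
    TangentSpace 𝓘(ℝ, E) p →ₗ[ℝ] TangentSpace 𝓘(ℝ, E) p →ₗ[ℝ]
      TangentSpace 𝓘(ℝ, E) p →ₗ[ℝ] TangentSpace 𝓘(ℝ, E) p :=
  LinearMap.mk₂ ℝ
    (fun u v ↦
      { toFun := curvature cov p u v
        map_add' := fun w w' ↦ by
          obtain ⟨X, hX, rfl⟩ := exists_isSmoothField_apply_eq u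
          obtain ⟨Y, hY, rfl⟩ := exists_isSmoothField_apply_eq v
          obtain ⟨Z, hZ, rfl⟩ := exists_isSmoothField_apply_eq w
          obtain ⟨Z', hZ', rfl⟩ := exists_isSmoothField_apply_eq w'
          rw [curvature_apply hsm hX hY hZ, curvature_apply hsm hX hY hZ',
            ← (smoothlyTensorialAt_curvatureField_right hsm hX hY p).add hZ hZ',
            ← curvature_apply hsm hX hY (hZ.add hZ')]
          rfl
        map_smul' := fun c w ↦ by
          obtain ⟨X, hX, rfl⟩ := exists_isSmoothField_apply_eq u
          obtain ⟨Y, hY, rfl⟩ := exists_isSmoothField_apply_eq v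
          obtain ⟨Z, hZ, rfl⟩ := exists_isSmoothField_apply_eq w
          have hc : ContMDiff 𝓘(ℝ, E) 𝓘(ℝ, ℝ) ∞ (fun _ : M ↦ c) := contMDiff_const
          rw [RingHom.id_apply, curvature_apply hsm hX hY hZ,
            ← (smoothlyTensorialAt_curvatureField_right hsm hX hY p).smul hc hZ,
            ← curvature_apply hsm hX hY (hZ.smul hc)]
          rfl })
    (fun u u' v ↦ by
      ext w
      obtain ⟨X, hX, rfl⟩ := exists_isSmoothField_apply_eq u
      obtain ⟨X', hX', rfl⟩ := exists_isSmoothField_apply_eq u'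
      obtain ⟨Y, hY, rfl⟩ := exists_isSmoothField_apply_eq v
      obtain ⟨Z, hZ, rfl⟩ := exists_isSmoothField_apply_eq w
      change curvature cov p ((X + X') p) (Y p) (Z p)
        = curvature cov p (X p) (Y p) (Z p) + curvature cov p (X' p) (Y p) (Z p)
      rw [curvature_apply hsm hX hY hZ, curvature_apply hsm hX' hY hZ,
        curvature_apply hsm (hX.add hX') hY hZ]
      exact (smoothlyTensorialAt_curvatureField_left hsm Y hZ p).add hX hX')
    (fun c u v ↦ by
      ext w
      obtain ⟨X, hX, rfl⟩ := exists_isSmoothField_apply_eq u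
      obtain ⟨Y, hY, rfl⟩ := exists_isSmoothField_apply_eq v
      obtain ⟨Z, hZ, rfl⟩ := exists_isSmoothField_apply_eq w
      have hc : ContMDiff 𝓘(ℝ, E) 𝓘(ℝ, ℝ) ∞ (fun _ : M ↦ c) := contMDiff_const
      change curvature cov p (((fun _ : M ↦ c) • X) p) (Y p) (Z p)
        = c • curvature cov p (X p) (Y p) (Z p)
      rw [curvature_apply hsm hX hY hZ, curvature_apply hsm (hX.smul hc) hY hZ]
      exact (smoothlyTensorialAt_curvatureField_left hsm Y hZ p).smul hc hX)
    (fun u v v' ↦ by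
      ext w
      obtain ⟨X, hX, rfl⟩ := exists_isSmoothField_apply_eq u
      obtain ⟨Y, hY, rfl⟩ := exists_isSmoothField_apply_eq v
      obtain ⟨Y', hY', rfl⟩ := exists_isSmoothField_apply_eq v'
      obtain ⟨Z, hZ, rfl⟩ := exists_isSmoothField_apply_eq w
      change curvature cov p (X p) ((Y + Y') p) (Z p)
        = curvature cov p (X p) (Y p) (Z p) + curvature cov p (X p) (Y' p) (Z p)
      rw [curvature_apply hsm hX hY hZ, curvature_apply hsm hX hY' hZ,
        curvature_apply hsm hX (hY.add hY') hZ]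
      exact (smoothlyTensorialAt_curvatureField_middle hsm X hZ p).add hY hY')
    (fun c u v ↦ by
      ext w
      obtain ⟨X, hX, rfl⟩ := exists_isSmoothField_apply_eq u
      obtain ⟨Y, hY, rfl⟩ := exists_isSmoothField_apply_eq v
      obtain ⟨Z, hZ, rfl⟩ := exists_isSmoothField_apply_eq w
      have hc : ContMDiff 𝓘(ℝ, E) 𝓘(ℝ, ℝ) ∞ (fun _ : M ↦ c) := contMDiff_const
      change curvature cov p (X p) (((fun _ : M ↦ c) • Y) p) (Z p)
        = c • curvature cov p (X p) (Y p) (Z p)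
      rw [curvature_apply hsm hX hY hZ, curvature_apply hsm hX (hY.smul hc) hZ]
      exact (smoothlyTensorialAt_curvatureField_middle hsm X hZ p).smul hc hY)

lemma curvatureHom_apply (hsm : cov.ContMDiffCovariantDerivative ∞) (p : M)
    (u v w : TangentSpace 𝓘(ℝ, E) p) : curvatureHom hsm p u v w = curvature cov p u v w := rfl

lemma curvatureHom_field (hsm : cov.ContMDiffCovariantDerivative ∞)
    (hX : IsSmoothField X) (hY : IsSmoothField Y) (hZ : IsSmoothField Z) (p : M) :
    curvatureHom hsm p (X p) (Y p) (Z p) = curvatureField cov X Y Z p :=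
  curvature_apply hsm hX hY hZ p

lemma IsSmoothField.curvatureHom (hsm : cov.ContMDiffCovariantDerivative ∞)
    (hX : IsSmoothField X) (hY : IsSmoothField Y) (hZ : IsSmoothField Z) :
    IsSmoothField (fun q ↦ curvatureHom hsm q (X q) (Y q) (Z q)) := by
  simp only [curvatureHom_field hsm hX hY hZ]
  exact hX.curvatureField hsm hY hZ

lemma isSmoothTensor_curvatureTensor (hsm : cov.ContMDiffCovariantDerivative ∞) :
    IsSmoothTensor (curvatureTensor cov) where
  map_update_add p v i x y := by
    simp only [curvatureTensor, ← curvatureHom_apply hsm]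
    fin_cases i <;> simp
  map_update_smul p v i c x := by
    simp only [curvatureTensor, ← curvatureHom_apply hsm]
    fin_cases i <;> simp
  smooth V hV := (hV 0).curvatureHom hsm (hV 1) (hV 2)

lemma curvatureHom_swap (hsm : cov.ContMDiffCovariantDerivative ∞) (p : M)
    (u v w : TangentSpace 𝓘(ℝ, E) p) : curvatureHom hsm p u v w = -curvatureHom hsm p v u w := by
  obtain ⟨X, hX, rfl⟩ := exists_isSmoothField_apply_eq u
  obtain ⟨Y, hY, rfl⟩ := exists_isSmoothField_apply_eq v
  obtain ⟨Z, hZ, rfl⟩ := exists_isSmoothField_apply_eq w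
  rw [curvatureHom_field hsm hX hY hZ, curvatureHom_field hsm hY hX hZ, curvatureField_swap]

lemma covDerivTensor_curvatureTensor (hsm : cov.ContMDiffCovariantDerivative ∞)
    (hA : IsSmoothField A) (hB : IsSmoothField B) (hC : IsSmoothField C) (p : M)
    (x : TangentSpace 𝓘(ℝ, E) p) :
    covDerivTensor cov (curvatureTensor cov) p ![x, A p, B p, C p]
      = cov (fun q ↦ curvatureHom hsm q (A q) (B q) (C q)) p x
        - curvatureHom hsm p (cov A p x) (B p) (C p)
        - curvatureHom hsm p (A p) (cov B p x) (C p)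
        - curvatureHom hsm p (A p) (B p) (cov C p x) := by
  have h := (isSmoothTensor_curvatureTensor hsm).covDerivTensor_apply (cov := cov) x
    (V := ![A, B, C]) (v := ![A p, B p, C p])
    (by intro i; fin_cases i <;> assumption) (by intro i; fin_cases i <;> rfl)
  refine h.trans ?_
  rw [leibnizExpansion, Fin.sum_univ_three]
  simp only [sub_sub]
  rfl

/-- `∇²_{X,Y} R` expanded with global smooth fields. -/
lemma secondCovDerivCurvature_eq (hsm : cov.ContMDiffCovariantDerivative ∞)
    (hY : IsSmoothField Y)
    (hA : IsSmoothField A) (hB : IsSmoothField B) (hC : IsSmoothField C) (p : M)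
    (x : TangentSpace 𝓘(ℝ, E) p) :
    secondCovDerivCurvature cov p x (Y p) (A p) (B p) (C p)
      = cov (fun q ↦ covDerivTensor cov (curvatureTensor cov) q ![Y q, A q, B q, C q]) p x
        - covDerivTensor cov (curvatureTensor cov) p ![cov Y p x, A p, B p, C p]
        - covDerivTensor cov (curvatureTensor cov) p ![Y p, cov A p x, B p, C p]
        - covDerivTensor cov (curvatureTensor cov) p ![Y p, A p, cov B p x, C p]
        - covDerivTensor cov (curvatureTensor cov) p ![Y p, A p, B p, cov C p x] := by
  have h : secondCovDerivCurvature cov p x (Y p) (A p) (B p) (C p)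
      = leibnizExpansion (n := 4) cov (covDerivTensor cov (curvatureTensor cov)) p x
          ![Y, A, B, C] :=
    ((isSmoothTensor_curvatureTensor hsm).covDerivTensor hsm).covDerivTensor_apply
    (cov := cov) x (V := ![Y, A, B, C]) (v := ![Y p, A p, B p, C p])
    (by intro i; fin_cases i <;> assumption) (by intro i; fin_cases i <;> rfl)
  have hfun (q : M) : (fun i ↦ (![Y, A, B, C] : Fin 4 → (q : M) → TangentSpace 𝓘(ℝ, E) q) i q)
      = ![Y q, A q, B q, C q] := by
    funext i; fin_cases i <;> rfl
  have h0 (z : TangentSpace 𝓘(ℝ, E) p) :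
      Function.update ![Y p, A p, B p, C p] 0 z = ![z, A p, B p, C p] := by
    funext i; fin_cases i <;> rfl
  have h1 (z : TangentSpace 𝓘(ℝ, E) p) :
      Function.update ![Y p, A p, B p, C p] 1 z = ![Y p, z, B p, C p] := by
    funext i; fin_cases i <;> rfl
  have h2 (z : TangentSpace 𝓘(ℝ, E) p) :
      Function.update ![Y p, A p, B p, C p] 2 z = ![Y p, A p, z, C p] := by
    funext i; fin_cases i <;> rfl
  have h3 (z : TangentSpace 𝓘(ℝ, E) p) :
      Function.update ![Y p, A p, B p, C p] 3 z = ![Y p, A p, B p, z] := by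
    funext i; fin_cases i <;> rfl
  rw [h, leibnizExpansion, Fin.sum_univ_four]
  simp only [hfun, h0, h1, h2, h3, sub_sub]
  rfl

/-- The Ricci identity: for a torsion-free connection, `∇²_{x,y} R - ∇²_{y,x} R` is the derivation
`R_{x,y}` of the tensor algebra applied to `R`. -/
lemma skewSecondCovDerivCurvature_eq (hsm : cov.ContMDiffCovariantDerivative ∞)
    (ht : cov.torsion = 0) (p : M) (x y a b c : TangentSpace 𝓘(ℝ, E) p) :
    skewSecondCovDerivCurvature cov p x y a b c
      = curvatureHom hsm p x y (curvatureHom hsm p a b c)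
        - curvatureHom hsm p (curvatureHom hsm p x y a) b c
        - curvatureHom hsm p a (curvatureHom hsm p x y b) c
        - curvatureHom hsm p a b (curvatureHom hsm p x y c) := by
  obtain ⟨X, hX, rfl⟩ := exists_isSmoothField_apply_eq x
  obtain ⟨Y, hY, rfl⟩ := exists_isSmoothField_apply_eq y
  obtain ⟨A, hA, rfl⟩ := exists_isSmoothField_apply_eq a
  obtain ⟨B, hB, rfl⟩ := exists_isSmoothField_apply_eq b
  obtain ⟨C, hC, rfl⟩ := exists_isSmoothField_apply_eq c
  have key {X Y : (q : M) → TangentSpace 𝓘(ℝ, E) q} (hX : IsSmoothField X)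
      (hY : IsSmoothField Y) := by
    have hfun : (fun q ↦ covDerivTensor cov (curvatureTensor cov) q ![Y q, A q, B q, C q])
        = (fun q ↦ cov (fun q ↦ curvatureHom hsm q (A q) (B q) (C q)) q (Y q))
          - (fun q ↦ curvatureHom hsm q (cov A q (Y q)) (B q) (C q))
          - (fun q ↦ curvatureHom hsm q (A q) (cov B q (Y q)) (C q))
          - (fun q ↦ curvatureHom hsm q (A q) (B q) (cov C q (Y q))) :=
      funext fun q ↦ covDerivTensor_curvatureTensor hsm hA hB hC q (Y q)
    have s0 := hY.covDeriv hsm (hA.curvatureHom hsm hB hC)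
    have s1 := (hY.covDeriv hsm hA).curvatureHom hsm hB hC
    have s2 := hA.curvatureHom hsm (hY.covDeriv hsm hB) hC
    have s3 := hA.curvatureHom hsm hB (hY.covDeriv hsm hC)
    have h := secondCovDerivCurvature_eq hsm hY hA hB hC p (X p)
    rw [hfun, cov_sub ((s0.sub s1).sub s2) s3, cov_sub (s0.sub s1) s2, cov_sub s0 s1,
      covDerivTensor_curvatureTensor hsm hA hB hC p,
      covDerivTensor_curvatureTensor hsm (hX.covDeriv hsm hA) hB hC p,
      covDerivTensor_curvatureTensor hsm hA (hX.covDeriv hsm hB) hC p,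
      covDerivTensor_curvatureTensor hsm hA hB (hX.covDeriv hsm hC) p] at h
    exact h
  have hbr := (cov.torsion_eq_zero_iff.1 ht (hX.mdifferentiableAt p) (hY.mdifferentiableAt p)).symm
  rw [curvatureHom_field hsm hX hY (hA.curvatureHom hsm hB hC),
    curvatureHom_field hsm hX hY hA, curvatureHom_field hsm hX hY hB,
    curvatureHom_field hsm hX hY hC, skewSecondCovDerivCurvature, key hX hY, key hY hX]
  simp only [curvatureField, hbr, map_sub, LinearMap.sub_apply, sub_apply]
  module

/-- The first Bianchi identity. -/
lemma curvatureHom_bianchi (hsm : cov.ContMDiffCovariantDerivative ∞)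
    (ht : cov.torsion = 0) (p : M) (x y z : TangentSpace 𝓘(ℝ, E) p) :
    curvatureHom hsm p x y z + curvatureHom hsm p y z x + curvatureHom hsm p z x y = 0 := by
  obtain ⟨X, hX, rfl⟩ := exists_isSmoothField_apply_eq x
  obtain ⟨Y, hY, rfl⟩ := exists_isSmoothField_apply_eq y
  obtain ⟨Z, hZ, rfl⟩ := exists_isSmoothField_apply_eq z
  have hbr {X Y : (q : M) → TangentSpace 𝓘(ℝ, E) q} (hX : IsSmoothField X)
      (hY : IsSmoothField Y) : VectorField.mlieBracket 𝓘(ℝ, E) X Y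
        = (fun q ↦ cov Y q (X q)) - fun q ↦ cov X q (Y q) :=
    funext fun q ↦ (cov.torsion_eq_zero_iff.1 ht (hX.mdifferentiableAt q)
      (hY.mdifferentiableAt q)).symm
  have hJ := hX.leibniz_identity_mlieBracket hY hZ p
  rw [hbr hX (hY.mlieBracket hZ), hbr (hX.mlieBracket hY) hZ, hbr hY (hX.mlieBracket hZ),
    hbr hY hZ, hbr hX hZ, hbr hX hY] at hJ
  simp only [Pi.sub_apply, map_sub, cov_sub (hX.covDeriv hsm hY) (hY.covDeriv hsm hX),
    cov_sub (hX.covDeriv hsm hZ) (hZ.covDeriv hsm hX),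
    cov_sub (hY.covDeriv hsm hZ) (hZ.covDeriv hsm hY), sub_apply] at hJ
  rw [curvatureHom_field hsm hX hY hZ, curvatureHom_field hsm hY hZ hX,
    curvatureHom_field hsm hZ hX hY]
  simp only [curvatureField, hbr hX hY, hbr hY hZ, hbr hZ hX, Pi.sub_apply, map_sub]
  linear_combination (norm := module) hJ

end CurvatureTensor

/-! ### Algebraic Kähler curvature tensors -/

section Algebra

variable {V : Type*} [AddCommGroup V] [Module ℝ V]

/-- The pair symmetry `g(R_{x,y} z, w) = g(R_{z,w} x, y)` of an algebraic curvature tensor. -/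
lemma pair_symmetry {R : V →ₗ[ℝ] V →ₗ[ℝ] V →ₗ[ℝ] V} {g : V →ₗ[ℝ] V →ₗ[ℝ] ℝ}
    (hswap : ∀ x y z, R x y z = -R y x z)
    (hbianchi : ∀ x y z, R x y z + R y z x + R z x y = 0)
    (hskew : ∀ x y z w, g (R x y z) w = -g (R x y w) z) (x y z w : V) :
    g (R x y z) w = g (R z w x) y := by
  have hB (x y z w) : g (R x y z) w + g (R y z x) w + g (R z x y) w = 0 := by
    rw [← LinearMap.add_apply, ← LinearMap.add_apply, ← map_add, ← map_add, hbianchi]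
    simp
  have hS (x y z w) : g (R x y z) w = -g (R y x z) w := by
    rw [hswap]; simp
  linarith [hB x y z w, hB y z w x, hB z w x y, hB w x y z,
    hskew x y z w, hskew y z w x, hskew z w x y, hskew w x y z, hskew x z w y, hskew y w z x,
    hskew z x y w, hskew y z x w, hskew w y z x, hskew x z y w, hskew z w y x, hskew w x z y,
    hskew w y x z, hskew y w x z, hskew x y w z, hskew z x w y,
    hS x y z w, hS y z x w, hS z x y w, hS y z w x, hS z w y x, hS w y z x, hS z w x y, hS w x z y,
    hS x z w y, hS w x y z, hS x y w z, hS y w x z]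

/-- The commutator identity for Kähler curvature tensors. The right-hand side consists of the
derivations `R_{x,y}` applied to the tensor `R`. All terms are reduced to the two Jacobi operators
`P = R_{x,·} x` and `Q = R_{Jx,·} Jx` by means of `R_{x,Jx} = J (P + Q)`, `P J = J Q` and
`Q J = J P`. -/
lemma three_smul_commutator {R : V →ₗ[ℝ] V →ₗ[ℝ] V →ₗ[ℝ] V} {J : V →ₗ[ℝ] V}
    (hJJ : ∀ x, J (J x) = -x)
    (hswap : ∀ x y z, R x y z = -R y x z)
    (hbianchi : ∀ x y z, R x y z + R y z x + R z x y = 0)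
    (hJ : ∀ x y z, R x y (J z) = J (R x y z))
    (hJR : ∀ x y z, R (J x) (J y) z = R x y z)
    {D : V → V → V → V → V → V}
    (hD : ∀ x y a b c, D x y a b c
      = R x y (R a b c) - R (R x y a) b c - R a (R x y b) c - R a b (R x y c)) (X A : V) :
    (3 : ℝ) • (R X (R (J X) A (J X)) X - R (J X) (R X A X) (J X))
      = (1 / 2 : ℝ) • D X (J X) X (J X) A + D X (J X) A X (J X) + D A X X (J X) (J X)
        + D A (J X) X (J X) X := by
  obtain ⟨Y, hY⟩ : ∃ Y, Y = J X := ⟨_, rfl⟩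
  obtain ⟨P, hP⟩ : ∃ P : V →ₗ[ℝ] V, ∀ a, P a = R X a X := ⟨(R X).flip X, fun _ ↦ rfl⟩
  obtain ⟨Q, hQ⟩ : ∃ Q : V →ₗ[ℝ] V, ∀ a, Q a = R Y a Y := ⟨(R Y).flip Y, fun _ ↦ rfl⟩
  have hX : X = -J Y := by rw [hY, hJJ, neg_neg]
  rw [← hY]
  have hXJ (z w) : R X (J z) w = -R Y z w := by
    rw [← hJR X (J z) w, hJJ, ← hY]; simp
  have hJY (z w) : R (J z) Y w = R z X w := by rw [hY, hJR]
  have hAXX (a) : R a X X = -P a := by rw [hP, hswap]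
  have hAXY (a) : R a X Y = -J (P a) := by rw [hY, hJ, hAXX, map_neg]
  have hXAY (a) : R X a Y = J (P a) := by rw [hswap, hAXY, neg_neg]
  have hAYY (a) : R a Y Y = -Q a := by rw [hQ, hswap]
  have hAYX (a) : R a Y X = J (Q a) := by rw [hX, map_neg, hJ, hAYY, map_neg, neg_neg]
  have hYAX (a) : R Y a X = -J (Q a) := by rw [hswap, hAYX]
  have hK (a) : R X Y a = J (P a) + J (Q a) := by
    have := hbianchi X Y a
    rw [hYAX, hAXY] at this
    linear_combination (norm := module) this
  have hPJ (a) : P (J a) = J (Q a) := by rw [hP, hXJ, hYAX, neg_neg]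
  have hQJ (a) : Q (J a) = J (P a) := by
    have h : J (P (J (J a))) = J (J (Q (J a))) := by rw [hPJ]
    rw [hJJ, hJJ, map_neg, map_neg] at h
    exact (neg_injective h).symm
  -- the terms in which `R_{x,y}` hits the first two arguments cancel by the Bianchi identity
  have hKY : R X Y Y = J (R X Y X) := by rw [← hJ, ← hY]
  have h1 : R X (R X Y Y) A = R (R X Y X) Y A := by rw [hKY, hXJ, ← hswap]
  have h2 : R (R X Y X) Y A + R Y A (R X Y X) + R A (R X Y X) Y = 0 := hbianchi _ _ _
  have h3 : R A Y (R X Y X) = -R Y A (R X Y X) := hswap _ _ _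
  have h4 : R (R X Y A) X Y = Q (P A) + Q (Q A) := by
    rw [hAXY, hK, map_add, hPJ, hPJ, map_add, hJJ, hJJ]; module
  have h5 : R (R A X X) Y Y = Q (P A) := by rw [hAYY, hAXX, map_neg, neg_neg]
  have h6 : R X (R A X Y) Y = Q (P A) := by
    rw [hXAY, hAXY, map_neg, hPJ, map_neg, hJJ, neg_neg]
  have h7 : R (R A Y X) Y X = -P (Q A) := by rw [hAYX, hAYX, hQJ, hJJ]
  have h8 : R X (R A Y Y) X = -P (Q A) := by rw [← hP, hAYY, map_neg]
  have h9 : R X Y (R A Y X) = -(P (Q A) + Q (Q A)) := by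
    rw [hAYX, hJ, hK, map_add, hJJ, hJJ]; module
  rw [hD, hD, hD, hD, h1, h4, h5, h6, h7, h8, h9, h3, ← hQ A, ← hP A, ← hP (Q A), ← hQ (P A)]
  linear_combination (norm := module) h2

end Algebra

/-! ### Curvature of Levi-Civita and Kähler connections -/

section Inner

variable {E : Type*} [NormedAddCommGroup E] [NormedSpace ℝ E]
  {M : Type*} [TopologicalSpace M] [ChartedSpace E M] [IsManifold 𝓘(ℝ, E) ∞ M]
  {X Y : (q : M) → TangentSpace 𝓘(ℝ, E) q}

lemma IsSmoothField.contMDiff_inner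
    (g : ContMDiffRiemannianMetric 𝓘(ℝ, E) ∞ E (fun x : M ↦ TangentSpace 𝓘(ℝ, E) x))
    (hX : IsSmoothField X) (hY : IsSmoothField Y) :
    ContMDiff 𝓘(ℝ, E) 𝓘(ℝ, ℝ) ∞ (fun q ↦ g.inner q (X q) (Y q)) := by
  have h : ContMDiff 𝓘(ℝ, E) (𝓘(ℝ, E).prod 𝓘(ℝ, ℝ)) ∞
      (fun q ↦ TotalSpace.mk' ℝ (E := Bundle.Trivial M ℝ) q (g.inner q (X q) (Y q))) :=
    ContMDiff.clm_bundle_apply₂ (F₁ := E) (F₂ := E) g.contMDiff hX hY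
  intro q
  have hq := h q
  simp only [contMDiffAt_totalSpace] at hq
  exact hq.2

end Inner

section Metric

variable {E : Type*} [NormedAddCommGroup E] [NormedSpace ℝ E] [FiniteDimensional ℝ E]
  {M : Type*} [TopologicalSpace M] [ChartedSpace E M] [IsManifold 𝓘(ℝ, E) ∞ M]
  {g : ContMDiffRiemannianMetric 𝓘(ℝ, E) ∞ E (fun x : M ↦ TangentSpace 𝓘(ℝ, E) x)}
  {cov : CovariantDerivative 𝓘(ℝ, E) E (fun x : M ↦ TangentSpace 𝓘(ℝ, E) x)}
  {J : (p : M) → TangentSpace 𝓘(ℝ, E) p →L[ℝ] TangentSpace 𝓘(ℝ, E) p}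
  {X Y : (q : M) → TangentSpace 𝓘(ℝ, E) q}

lemma IsKahler.isSmoothField (h : IsKahler g cov J) (hX : IsSmoothField X) :
    IsSmoothField (fun q ↦ J q (X q)) :=
  ContMDiff.clm_bundle_apply (F₁ := E) (F₂ := E) (b := id) h.smooth hX

variable [T2Space M]

/-- For a metric connection the curvature operators `R_{x,y}` are skew-symmetric: apply the
commutator `X Y - Y X - [X, Y]` to the function `g(Z, W)`. -/
lemma IsLeviCivita.inner_curvatureHom (h : IsLeviCivita g cov) (p : M)
    (x y z w : TangentSpace 𝓘(ℝ, E) p) :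
    g.inner p (curvatureHom h.smooth p x y z) w = -g.inner p (curvatureHom h.smooth p x y w) z := by
  obtain ⟨X, hX, rfl⟩ := exists_isSmoothField_apply_eq x
  obtain ⟨Y, hY, rfl⟩ := exists_isSmoothField_apply_eq y
  obtain ⟨Z, hZ, rfl⟩ := exists_isSmoothField_apply_eq z
  obtain ⟨W, hW, rfl⟩ := exists_isSmoothField_apply_eq w
  have hsm := h.smooth
  have hd {U V : (q : M) → TangentSpace 𝓘(ℝ, E) q} (hU : IsSmoothField U)
      (hV : IsSmoothField V) (q : M) (x : TangentSpace 𝓘(ℝ, E) q) :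
      d% (fun q ↦ g.inner q (U q) (V q)) q x
        = g.inner q (cov U q x) (V q) + g.inner q (U q) (cov V q x) :=
    h.metric q x U V (hU.mdifferentiableAt q) (hV.mdifferentiableAt q)
  have hdf {U V : (q : M) → TangentSpace 𝓘(ℝ, E) q} (hU : IsSmoothField U)
      (hV : IsSmoothField V) : MDiffAt (fun q ↦ g.inner q (U q) (V q)) p :=
    (hU.contMDiff_inner g hV p).mdifferentiableAt (by simp)
  have hf := hZ.contMDiff_inner g hW
  -- the second derivative of `g(Z, W)`, first along `V` and then along `U`
  have hdd {U V : (q : M) → TangentSpace 𝓘(ℝ, E) q} (hV : IsSmoothField V) :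
      d% (fun q ↦ d% (fun q ↦ g.inner q (Z q) (W q)) q (V q)) p (U p)
        = g.inner p (cov (fun q ↦ cov Z q (V q)) p (U p)) (W p)
          + g.inner p (cov Z p (V p)) (cov W p (U p))
          + (g.inner p (cov Z p (U p)) (cov W p (V p))
          + g.inner p (Z p) (cov (fun q ↦ cov W q (V q)) p (U p))) := by
    have hZV := hV.covDeriv hsm hZ
    have hWV := hV.covDeriv hsm hW
    rw [← hd hZV hW, ← hd hZ hWV]
    simp only [hd hZ hW]
    rw [mvfderiv_fun_add (hdf hZV hW) (hdf hZ hWV)]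
    rfl
  have hXY := mvfderiv_mlieBracket hX hY hf
    ((contMDiff_mvfderiv_apply hf hX p).mdifferentiableAt (by simp))
    ((contMDiff_mvfderiv_apply hf hY p).mdifferentiableAt (by simp))
  rw [hdd hY, hdd hX, hd hZ hW] at hXY
  rw [curvatureHom_field hsm hX hY hZ, curvatureHom_field hsm hX hY hW,
    g.symm p (curvatureField cov X Y W p)]
  simp only [curvatureField, map_sub, sub_apply]
  linarith

lemma IsKahler.curvatureHom_apply_complex (h : IsKahler g cov J) (p : M)
    (x y z : TangentSpace 𝓘(ℝ, E) p) :
    curvatureHom h.isLeviCivita.smooth p x y (J p z)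
      = J p (curvatureHom h.isLeviCivita.smooth p x y z) := by
  obtain ⟨X, hX, rfl⟩ := exists_isSmoothField_apply_eq x
  obtain ⟨Y, hY, rfl⟩ := exists_isSmoothField_apply_eq y
  obtain ⟨Z, hZ, rfl⟩ := exists_isSmoothField_apply_eq z
  have hsm := h.isLeviCivita.smooth
  have hp {U : (q : M) → TangentSpace 𝓘(ℝ, E) q} (hU : IsSmoothField U) (q : M)
      (x : TangentSpace 𝓘(ℝ, E) q) : cov (fun q ↦ J q (U q)) q x = J q (cov U q x) :=
    h.parallel q x U (hU.mdifferentiableAt q)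
  rw [curvatureHom_field hsm hX hY hZ, curvatureHom_field hsm hX hY (h.isSmoothField hZ)]
  simp only [curvatureField, hp hZ, hp (hX.covDeriv hsm hZ), hp (hY.covDeriv hsm hZ), map_sub]

/-- `R_{Jx,Jy} = R_{x,y}`, by pair symmetry from the fact that the operators `R_{z,w}` commute
with the orthogonal map `J`. -/
lemma IsKahler.curvatureHom_complex_complex (h : IsKahler g cov J) (p : M)
    (x y z : TangentSpace 𝓘(ℝ, E) p) :
    curvatureHom h.isLeviCivita.smooth p (J p x) (J p y) z
      = curvatureHom h.isLeviCivita.smooth p x y z := by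
  have hsm := h.isLeviCivita.smooth
  let G : TangentSpace 𝓘(ℝ, E) p →ₗ[ℝ] TangentSpace 𝓘(ℝ, E) p →ₗ[ℝ] ℝ :=
    ContinuousLinearMap.coeLM ℝ ∘ₗ (g.inner p).toLinearMap
  have hpair := pair_symmetry (R := curvatureHom hsm p) (g := G) (curvatureHom_swap hsm p)
    (curvatureHom_bianchi hsm h.isLeviCivita.torsion_eq_zero p)
    (h.isLeviCivita.inner_curvatureHom p)
  have hz : ∀ w, g.inner p (curvatureHom hsm p (J p x) (J p y) z - curvatureHom hsm p x y z) w
      = 0 := by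
    intro w
    have h1 : g.inner p (curvatureHom hsm p (J p x) (J p y) z) w
        = g.inner p (curvatureHom hsm p z w (J p x)) (J p y) := hpair _ _ _ _
    have h2 : g.inner p (curvatureHom hsm p x y z) w
        = g.inner p (curvatureHom hsm p z w x) y := hpair _ _ _ _
    rw [map_sub, sub_apply, h1, h2, h.curvatureHom_apply_complex,
      h.orthogonal, sub_self]
  by_contra hne
  exact (g.pos p _ (sub_ne_zero.2 hne)).ne' (hz _)

end Metric

section LocallySymmetric

variable {E : Type*} [NormedAddCommGroup E] [NormedSpace ℝ E]
  {M : Type*} [TopologicalSpace M] [ChartedSpace E M] [IsManifold 𝓘(ℝ, E) ∞ M]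
  {cov : CovariantDerivative 𝓘(ℝ, E) E (fun x : M ↦ TangentSpace 𝓘(ℝ, E) x)}

lemma IsLocallySymmetric.skewSecondCovDerivCurvature_eq_zero
    (h : IsLocallySymmetric cov) (p : M) (x y a b c : TangentSpace 𝓘(ℝ, E) p) :
    skewSecondCovDerivCurvature cov p x y a b c = 0 := by
  have h0 : covDerivTensor cov (curvatureTensor cov) = fun _ _ ↦ 0 := by
    funext q v
    have hv : v = ![v 0, v 1, v 2, v 3] := by
      funext i; fin_cases i <;> rfl
    rw [hv]
    exact h q _ _ _ _
  have hcov : cov (fun _ ↦ 0) p = 0 := congrFun cov.zero p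
  rw [skewSecondCovDerivCurvature, secondCovDerivCurvature, secondCovDerivCurvature, h0]
  simp [covDerivTensor, hcov]

end LocallySymmetric

end KahlerGeometry

theorem mainTheorem11
    {E : Type*} [NormedAddCommGroup E] [NormedSpace ℝ E] [FiniteDimensional ℝ E]
    {M : Type*} [TopologicalSpace M] [T2Space M] [ChartedSpace E M] [IsManifold 𝓘(ℝ, E) ∞ M]
    (g : ContMDiffRiemannianMetric 𝓘(ℝ, E) ∞ E (fun x : M ↦ TangentSpace 𝓘(ℝ, E) x))
    (cov : CovariantDerivative 𝓘(ℝ, E) E (fun x : M ↦ TangentSpace 𝓘(ℝ, E) x))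
    (J : (p : M) → TangentSpace 𝓘(ℝ, E) p →L[ℝ] TangentSpace 𝓘(ℝ, E) p)
    (hK : KahlerGeometry.IsKahler g cov J) :
    (∀ (p : M) (X A : TangentSpace 𝓘(ℝ, E) p),
      (3 : ℝ) •
        (KahlerGeometry.jacobiOperator cov p X (KahlerGeometry.jacobiOperator cov p (J p X) A)
          - KahlerGeometry.jacobiOperator cov p (J p X) (KahlerGeometry.jacobiOperator cov p X A))
      = (1 / 2 : ℝ) • KahlerGeometry.skewSecondCovDerivCurvature cov p X (J p X) X (J p X) A
        + KahlerGeometry.skewSecondCovDerivCurvature cov p X (J p X) A X (J p X)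
        + KahlerGeometry.skewSecondCovDerivCurvature cov p A X X (J p X) (J p X)
        + KahlerGeometry.skewSecondCovDerivCurvature cov p A (J p X) X (J p X) X) ∧
    (KahlerGeometry.IsLocallySymmetric cov →
      ∀ (p : M) (X : TangentSpace 𝓘(ℝ, E) p),
        Function.Commute (KahlerGeometry.jacobiOperator cov p X)
          (KahlerGeometry.jacobiOperator cov p (J p X))) := by
  have hsm := hK.isLeviCivita.smooth
  have ht := hK.isLeviCivita.torsion_eq_zero
  have key (p : M) (X A : TangentSpace 𝓘(ℝ, E) p) :=
    KahlerGeometry.three_smul_commutator (R := KahlerGeometry.curvatureHom hsm p)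
      (J := (J p).toLinearMap) (hK.sq_eq_neg p) (KahlerGeometry.curvatureHom_swap hsm p)
      (KahlerGeometry.curvatureHom_bianchi hsm ht p) (hK.curvatureHom_apply_complex p)
      (hK.curvatureHom_complex_complex p)
      (D := KahlerGeometry.skewSecondCovDerivCurvature cov p)
      (KahlerGeometry.skewSecondCovDerivCurvature_eq hsm ht p) X A
  refine ⟨key, fun hsymm p X A ↦ ?_⟩
  have h := key p X A
  simp only [hsymm.skewSecondCovDerivCurvature_eq_zero, smul_zero, add_zero] at h
  exact sub_eq_zero.1 ((smul_eq_zero.1 h).resolve_left three_ne_zero)
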